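/- Let $l\ge 1$ be an integer, let $S$ be a (finite) abelian group of order $2l+1$, and let $\chi:S\to\mathbb C^{\times}$ be an injective group homomorphism (so $S$ is cyclic). Let $D_S$ be the Lie algebra over $\mathbb C$ with generators $\mathbf c$ and $D^{\alpha}(n)$ $(\alpha\in S,\ n\in\mathbb Z)$, subject to the relations that $\mathbf c$ is central, $D^{-\alpha}(n)=-D^{\alpha}(n)$, and $$[D^{\alpha}(n),D^{\beta}(m)]=\bigl(\chi(m\alpha-n\beta)-\chi(n\beta-m\alpha)\bigr)D^{\alpha+\beta}(m+n)-\bigl(\chi(m\alpha+n\beta)-\chi(-m\alpha-n\beta)\bigr)D^{\alpha-\beta}(m+n)+\bigl([m]_{\chi(\alpha+\beta)}-[m]_{\chi(\alpha-\beta)}\bigr)\delta_{m+n,0}\,\mathbf c$$ for $\alpha,\beta\in S$ and $m,n\in\mathbb Z$, where $[m]_q=\dfrac{q^m-q^{-m}}{q-q^{-1}}$ for $q\in\mathbb C^\times$, $q\neq\pm1$, and $[m]_1=m$, $[m]_{-1}=(-1)^{m-1}m$. Then $D_S$ is isomorphic, as a Lie algebra over $\mathbb C$, to the affine Kac–Moody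 algebra of type $B_l^{(1)}$ (without derivation), that is, to $$\widehat{\mathfrak g}=\mathfrak g\otimes\mathbb C[t,t^{-1}]\oplus\mathbb C\mathbf k,\qquad [a\otimes t^m,b\otimes t^n]=[a,b]\otimes t^{m+n}+m\,\delta_{m+n,0}\langle a,b\rangle\mathbf k,\quad \mathbf k\ \text{central},$$ where $\mathfrak g=\mathfrak{so}(2l+1,\mathbb C)$ is the simple Lie algebra of type $B_l$ and $\langle a,b\rangle=\tfrac12\operatorname{tr}(ab)$. -/

import Mathlib

namespace QVirasoro

/-- The `q`-integer `[n]_q = (qⁿ - q⁻ⁿ) / (q - q⁻¹)` of a nonzero complex number `q`, with the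
limit values `[n]_1 = n` and `[n]_{-1} = (-1)ⁿ⁻¹ n`. -/
noncomputable def qInt (q : ℂ) (n : ℤ) : ℂ :=
  if q = 1 then (n : ℂ)
  else if q = -1 then (n : ℂ) * (-1 : ℂ) ^ (n - 1)
  else (q ^ n - q ^ (-n)) / (q - q⁻¹)

/-- The generators of `D_S`: the symbols `D^α(n)`, for `α ∈ S` and `n ∈ ℤ`, and the symbol `c`. -/
inductive Gen (S : Type*) : Type _
  | D (α : S) (n : ℤ) : Gen S
  | c : Gen S

variable {S : Type*} [AddCommGroup S]

/-- `D^α(n)` as an element of the free Lie algebra on the generators. -/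
noncomputable def freeD (α : S) (n : ℤ) : FreeLieAlgebra ℂ (Gen S) :=
  FreeLieAlgebra.of ℂ (Gen.D α n)

/-- `c` as an element of the free Lie algebra on the generators. -/
noncomputable def freeC (S : Type*) : FreeLieAlgebra ℂ (Gen S) :=
  FreeLieAlgebra.of ℂ Gen.c

/-- The right-hand side of the relation for the bracket of `D^α(n)` and `D^β(m)`. -/
noncomputable def bracketRHS (χ : AddChar S ℂˣ) (α β : S) (n m : ℤ) :
    FreeLieAlgebra ℂ (Gen S) :=
  ((χ (m • α - n • β) : ℂ) - (χ (n • β - m • α) : ℂ)) • freeD (α + β) (m + n)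
    - ((χ (m • α + n • β) : ℂ) - (χ (-(m • α) - n • β) : ℂ)) • freeD (α - β) (m + n)
    + ((qInt (χ (α + β) : ℂ) m - qInt (χ (α - β) : ℂ) m) * (if m + n = 0 then 1 else 0)) • freeC S

/-- The relators of `D_S`. -/
inductive IsRelator (χ : AddChar S ℂˣ) : FreeLieAlgebra ℂ (Gen S) → Prop
  | odd (α : S) (n : ℤ) : IsRelator χ (freeD (-α) n - -freeD α n)
  | bracket (α β : S) (n m : ℤ) :
      IsRelator χ (⁅freeD α n, freeD β m⁆ - bracketRHS χ α β n m)
  | central (x : FreeLieAlgebra ℂ (Gen S)) : IsRelator χ ⁅freeC S, x⁆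

/-- The ideal of the free Lie algebra generated by the relators. -/
noncomputable def relIdeal (χ : AddChar S ℂˣ) : LieIdeal ℂ (FreeLieAlgebra ℂ (Gen S)) :=
  LieSubmodule.lieSpan ℂ (FreeLieAlgebra ℂ (Gen S)) {x | IsRelator χ x}

/-- The Lie algebra `D_S` attached to the abelian group `S` and the linear character `χ`. -/
noncomputable abbrev DS (χ : AddChar S ℂˣ) : Type _ :=
  FreeLieAlgebra ℂ (Gen S) ⧸ relIdeal χ

end QVirasoro

namespace AffineLie

/-- The (untwisted) affine Lie algebra `𝔤 ⊗ ℂ[t, t⁻¹] ⊕ ℂ k` of a Lie algebra `𝔤` with a symmetric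
invariant bilinear form `Φ`: `k` is central and
`[a ⊗ tᵐ, b ⊗ tⁿ] = [a, b] ⊗ tᵐ⁺ⁿ + m δ_{m+n,0} Φ(a, b) k`.
The factor `-1` is there because Mathlib's cocycle on the loop algebra takes the value
`n δ_{m+n,0} Φ(a, b) = - m δ_{m+n,0} Φ(a, b)` at `(a ⊗ tᵐ, b ⊗ tⁿ)`. -/
noncomputable abbrev affine (𝔤 : Type*) [LieRing 𝔤] [LieAlgebra ℂ 𝔤]
    (Φ : LinearMap.BilinForm ℂ 𝔤) (hinv : Φ.lieInvariant 𝔤) (hsymm : Φ.IsSymm) : Type _ :=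
  LieAlgebra.ofTwoCocycle
    ((-1 : ℂ) • LieAlgebra.LoopAlgebra.twoCocycleOfBilinear ℂ ℤ 𝔤 Φ hinv hsymm)

/-- The finite-dimensional Lie algebra of type `B_l`, i.e. the orthogonal Lie algebra of a
nondegenerate symmetric bilinear form on a complex vector space of dimension `2l + 1`. -/
abbrev B (l : ℕ) :=
  LieAlgebra.Orthogonal.typeB (Fin l) ℂ

/-- The invariant form `⟨X, Y⟩ = ½ tr(XY)` on the Lie algebra of type `B_l`. -/
noncomputable def formB (l : ℕ) : LinearMap.BilinForm ℂ (B l) :=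
  LinearMap.mk₂ ℂ (fun X Y : B l => (1 / 2 : ℂ) * Matrix.trace (X.1 * Y.1))
    (by intro X X' Y; simp [add_mul, mul_add])
    (by intro r X Y; simp; ring)
    (by intro X Y Y'; simp [mul_add])
    (by intro r X Y; simp; ring)

theorem formB_symm (l : ℕ) : (formB l).IsSymm := by
  refine ⟨fun X Y => ?_⟩
  simp [formB, Matrix.trace_mul_comm X.1 Y.1]

theorem formB_inv (l : ℕ) : (formB l).lieInvariant (B l) := by
  intro X Y Z
  have h : Matrix.trace (X.1 * (Y.1 * Z.1)) = Matrix.trace (Y.1 * (Z.1 * X.1)) := by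
    rw [Matrix.trace_mul_comm, Matrix.mul_assoc]
  simp only [formB, LinearMap.mk₂_apply, LieSubalgebra.coe_bracket, Ring.lie_def, sub_mul, mul_sub,
    Matrix.trace_sub, Matrix.mul_assoc]
  rw [h]
  ring

/-- The affine Kac-Moody algebra of type `B_l⁽¹⁾` (without derivation), realised as the affine Lie
algebra of the Lie algebra of type `B_l`. -/
noncomputable abbrev affineB (l : ℕ) : Type :=
  affine (B l) (formB l) (formB_inv l) (formB_symm l)

end AffineLie

/-! Put N = 2l + 1 and index rows and columns by the weights -l, ..., l, a complete residue system
modulo N. Grade matrices of Laurent polynomials by giving t degree N and E_ij degree wⱼ - wᵢ. The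
matrices T^α(n) of `torusMatrix` are homogeneous of degree n and multiply as a quantum torus at
roots of unity, T^α(n) T^β(m) = χ(mα - nβ) T^{α+β}(m+n) (`torusMatrix_mul`). The antidiagonal
transpose sends T^α to T^{-α}, so T^α(n) - T^{-α}(n) lies in the loop algebra of so(N), once the
form is rescaled to be antidiagonal. Commutators of these differences give the noncentral part of
the relations (`loopD_lie`).

For the central part, N t d/dt acts on degree n as n plus the commutator with the diagonal matrix of
weights (`map_euler_torusMatrix`). The residue cocycle thus reduces to sums of wᵢ q^{wᵢ} over a root
of unity q, whose values produce the q-integers (`traceRes_mul_map_euler`). This gives a morphism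
from D_S with D^α(n) ↦ T^α(n) - T^{-α}(n) and c ↦ -k.

It is bijective because D_S is spanned by c and the D^α(n) (`span_genD_genC`), while Fourier
inversion on S recovers each t^k E_ij from the T^α(n) (`fourier_torusMatrix`,
`fourier_torusMatrix_eq_id`). The same Fourier formula, applied to the D^α(n), defines the inverse.
-/

namespace TypeBLoop

open AddMonoidAlgebra

/-! ### Weights as residues modulo 2l + 1. -/

/-- The index set of the matrices in the Lie algebra of type `B_l`. -/
abbrev Idx (l : ℕ) := Unit ⊕ Fin l ⊕ Fin l

/-- The weight of an index, an integer between `-l` and `l`. -/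
def wt {l : ℕ} : Idx l → ℤ
  | .inl _ => 0
  | .inr (.inl i) => (i : ℤ) + 1
  | .inr (.inr i) => -((i : ℤ) + 1)

/-- The involution of the index set that negates the weights. -/
def opp {l : ℕ} : Idx l → Idx l
  | .inl x => .inl x
  | .inr (.inl i) => .inr (.inr i)
  | .inr (.inr i) => .inr (.inl i)

@[simp] theorem opp_opp {l : ℕ} (i : Idx l) : opp (opp i) = i := by
  rcases i with _ | _ | _ <;> rfl

@[simp] theorem wt_opp {l : ℕ} (i : Idx l) : wt (opp i) = -wt i := by
  rcases i with _ | _ | _ <;> simp [wt, opp]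

theorem wt_inj_mod {l : ℕ} {i j : Idx l} (h : (2 * l + 1 : ℤ) ∣ wt i - wt j) : i = j := by
  have key : ∀ i : Idx l, -(l : ℤ) ≤ wt i ∧ wt i ≤ l := by
    rintro (_ | i | i)
    · simp [wt]
    · have := i.2; simp only [wt]; omega
    · have := i.2; simp only [wt]; omega
  have hw : wt i = wt j := by
    have h1 := key i
    have h2 := key j
    have := Int.eq_zero_of_abs_lt_dvd h (by rw [abs_lt]; constructor <;> linarith)
    linarith
  rcases i with i | i | i <;> rcases j with j | j | j <;> simp only [wt] at hw
  · rfl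
  · omega
  · omega
  · omega
  · have : i = j := by ext; omega
    rw [this]
  · omega
  · omega
  · omega
  · have : i = j := by ext; omega
    rw [this]

/-- Counting: the weights are distinct modulo 2l + 1 and there are 2l + 1 of them. -/
theorem exists_wt_mod (l : ℕ) (a : ℤ) : ∃ i : Idx l, (2 * l + 1 : ℤ) ∣ a - wt i := by
  have hinj : Function.Injective (fun i : Idx l => ((wt i : ℤ) : ZMod (2 * l + 1))) := by
    intro i j h
    apply wt_inj_mod
    have := (ZMod.intCast_eq_intCast_iff_dvd_sub _ _ _).1 h.symm
    exact_mod_cast this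
  have hb := (Fintype.bijective_iff_injective_and_card _).2 ⟨hinj, by simp; ring⟩
  obtain ⟨i, hi⟩ := hb.2 (a : ZMod (2 * l + 1))
  refine ⟨i, ?_⟩
  have := (ZMod.intCast_eq_intCast_iff_dvd_sub _ _ _).1 hi
  exact_mod_cast this

/-! ### Geometric sums over the weights. -/

section Sums

theorem sum_wt {l : ℕ} {M : Type*} [AddCommMonoid M] (f : ℤ → M) :
    ∑ i : Idx l, f (wt i) =
      f 0 + (∑ j ∈ Finset.range l, f (j + 1) + ∑ j ∈ Finset.range l, f (-(j + 1))) := by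
  simp [Fintype.sum_sum_type, wt, Finset.sum_range]

theorem geom_sum_wt (l : ℕ) {q : ℂ} (hq : q ≠ 0) :
    (q - 1) * ∑ i : Idx l, q ^ wt i = q ^ (l + 1 : ℤ) - q ^ (-l : ℤ) := by
  rw [sum_wt (fun k => q ^ k)]
  induction l with
  | zero => simp
  | succ l ih =>
    rw [Finset.sum_range_succ, Finset.sum_range_succ]
    have e1 : q ^ ((l + 1 : ℕ) + 1 : ℤ) = q ^ (l + 1 : ℤ) * q := by
      push_cast; rw [zpow_add_one₀ hq]
    have e2 : q ^ (-l : ℤ) = q ^ (-(l + 1 : ℤ)) * q := by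
      rw [← zpow_add_one₀ hq]; congr 1; ring
    rw [e2] at ih
    rw [e1]
    push_cast at ih ⊢
    linear_combination ih

/-- Summation by parts. The factor `q - 1` stays on the left so that the induction needs no
division. -/
theorem weighted_geom_sum_wt (l : ℕ) {q : ℂ} (hq : q ≠ 0) :
    (q - 1) * ∑ i : Idx l, (wt i : ℂ) * q ^ wt i =
      l * q ^ (l + 1 : ℤ) + (l + 1) * q ^ (-l : ℤ) - ∑ i : Idx l, q ^ wt i := by
  rw [sum_wt (fun k => q ^ k), sum_wt (fun k => (k : ℂ) * q ^ k)]
  induction l with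
  | zero => simp
  | succ l ih =>
    simp only [Finset.sum_range_succ]
    have e1 : q ^ ((l + 1 : ℕ) + 1 : ℤ) = q ^ (l + 1 : ℤ) * q := by
      push_cast; rw [zpow_add_one₀ hq]
    have e2 : q ^ (-l : ℤ) = q ^ (-(l + 1 : ℤ)) * q := by
      rw [← zpow_add_one₀ hq]; congr 1; ring
    rw [e2] at ih
    rw [e1]
    push_cast at ih ⊢
    linear_combination ih

/-- The two end terms of the telescoped sum cancel, since l + 1 and -l agree modulo 2l + 1. -/
theorem sum_zpow_wt_eq_zero {l : ℕ} {q : ℂ} (hq : q ^ (2 * l + 1) = 1) (h1 : q ≠ 1) :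
    ∑ i : Idx l, q ^ wt i = 0 := by
  have h0 : q ≠ 0 := by rintro rfl; simp at hq
  have h := geom_sum_wt l h0
  have e : q ^ (l + 1 : ℤ) = q ^ (-l : ℤ) := by
    rw [show (l + 1 : ℤ) = (2 * l + 1 : ℕ) + (-l : ℤ) by push_cast; ring, zpow_add₀ h0,
      zpow_natCast, hq, one_mul]
  rw [e, sub_self] at h
  exact (mul_eq_zero.1 h).resolve_left (sub_ne_zero.2 h1)

theorem sum_wt_mul_zpow_wt {l : ℕ} {q : ℂ} (hq : q ^ (2 * l + 1) = 1) (h1 : q ≠ 1) :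
    (q - 1) * ∑ i : Idx l, (wt i : ℂ) * q ^ wt i = (2 * l + 1) * q ^ (-l : ℤ) := by
  have h0 : q ≠ 0 := by rintro rfl; simp at hq
  rw [weighted_geom_sum_wt l h0, sum_zpow_wt_eq_zero hq h1]
  have e : q ^ (l + 1 : ℤ) = q ^ (-l : ℤ) := by
    rw [show (l + 1 : ℤ) = (2 * l + 1 : ℕ) + (-l : ℤ) by push_cast; ring, zpow_add₀ h0,
      zpow_natCast, hq, one_mul]
  rw [e]; ring

end Sums

/-! ### Orthogonality relations for the character. -/

section Characters

variable {S : Type*} [AddCommGroup S] {l : ℕ}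

theorem zsmul_congr_of_dvd (hS : Nat.card S = 2 * l + 1) {a b : ℤ}
    (h : (2 * l + 1 : ℤ) ∣ a - b) (α : S) : a • α = b • α := by
  obtain ⟨c, hc⟩ := h
  have h0 : (2 * l + 1 : ℤ) • α = 0 := by
    have := card_nsmul_eq_zero' (x := α)
    rw [hS] at this
    exact_mod_cast this
  rw [← sub_eq_zero, ← sub_smul, hc, mul_comm, mul_zsmul, h0, zsmul_zero]

theorem eq_zero_of_two_zsmul (hS : Nat.card S = 2 * l + 1) {α : S} (h : (2 : ℤ) • α = 0) :
    α = 0 := by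
  have h1 := zsmul_congr_of_dvd hS (a := 2 * l + 1) (b := 0) (by simp) α
  rw [add_zsmul, mul_comm, mul_zsmul, h] at h1
  simpa using h1

variable (χ : AddChar S ℂˣ)

theorem coe_map_zsmul (n : ℤ) (α : S) : ((χ (n • α) : ℂˣ) : ℂ) = (χ α : ℂ) ^ n := by
  rw [AddChar.map_zsmul_eq_zpow]; simp

theorem coe_map_add (α β : S) : ((χ (α + β) : ℂˣ) : ℂ) = (χ α : ℂ) * χ β := by
  rw [AddChar.map_add_eq_mul]; simp

theorem coe_pow_card (hS : Nat.card S = 2 * l + 1) (α : S) : (χ α : ℂ) ^ (2 * l + 1) = 1 := by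
  have := card_nsmul_eq_zero' (x := α)
  rw [hS] at this
  have h := coe_map_zsmul χ ((2 * l + 1 : ℕ) : ℤ) α
  rw [natCast_zsmul, this, zpow_natCast] at h
  simpa using h.symm

variable {χ}

theorem coe_eq_one_iff (hχ : Function.Injective χ) {α : S} : (χ α : ℂ) = 1 ↔ α = 0 := by
  rw [Units.val_eq_one, ← AddChar.map_zero_eq_one χ, hχ.eq_iff]

/-- The factor χ(nδ) comes out, leaving powers of χ(2δ); this is not 1 for δ ≠ 0 because the order
of S is odd. -/
theorem sum_wt_char (hS : Nat.card S = 2 * l + 1) (hχ : Function.Injective χ) (n : ℤ) (δ : S)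
    [Decidable (δ = 0)] :
    ∑ i : Idx l, (χ ((2 * wt i + n) • δ) : ℂ) = if δ = 0 then (2 * l + 1 : ℂ) else 0 := by
  split_ifs with h
  · subst h; simp; ring
  · have : ∀ i : Idx l, (χ ((2 * wt i + n) • δ) : ℂ) =
        χ (n • δ) * (χ ((2 : ℤ) • δ) : ℂ) ^ wt i := by
      intro i
      rw [← coe_map_zsmul, ← coe_map_add, ← mul_zsmul, ← add_zsmul]
      congr 3; ring
    simp_rw [this]
    rw [← Finset.mul_sum, sum_zpow_wt_eq_zero (coe_pow_card χ hS _), mul_zero]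
    rw [Ne, coe_eq_one_iff hχ]
    exact fun h2 => h (eq_zero_of_two_zsmul hS h2)

theorem sum_char_group [Fintype S] (hS : Nat.card S = 2 * l + 1) (hχ : Function.Injective χ)
    (b : ℤ) [Decidable ((2 * l + 1 : ℤ) ∣ b)] :
    ∑ α : S, (χ (b • α) : ℂ) = if (2 * l + 1 : ℤ) ∣ b then (2 * l + 1 : ℂ) else 0 := by
  split_ifs with h
  · have : ∀ α : S, b • α = 0 := fun α => by
      rw [zsmul_congr_of_dvd hS (a := b) (b := 0) (by simpa using h), zero_zsmul]
    simp only [this, AddChar.map_zero_eq_one, Units.val_one, Finset.sum_const, Finset.card_univ,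
      nsmul_eq_mul, mul_one]
    rw [← Nat.card_eq_fintype_card, hS]; push_cast; rfl
  -- A finite subgroup of ℂˣ is cyclic; a generator has order 2l + 1, so it is not killed by `b`.
  -- Translating the sum by it multiplies the sum by a number other than 1.
  · have hcyc : IsCyclic (Multiplicative S) :=
      isCyclic_of_injective_ringHom (R := ℂ) ((Units.coeHom ℂ).comp χ.toMonoidHom)
        (Units.val_injective.comp hχ)
    obtain ⟨g, hg⟩ := hcyc.exists_generator
    have hord : orderOf g = 2 * l + 1 := by
      rw [orderOf_eq_card_of_forall_mem_zpowers hg, ← hS]; rfl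
    have hne : b • (Multiplicative.toAdd g) ≠ 0 := by
      intro h0
      apply h
      have : g ^ b = 1 := h0
      rw [← orderOf_dvd_iff_zpow_eq_one, hord] at this
      exact_mod_cast this
    set x := Multiplicative.toAdd g
    have hs : (χ (b • x) : ℂ) * ∑ α : S, (χ (b • α) : ℂ) = ∑ α : S, (χ (b • α) : ℂ) := by
      rw [Finset.mul_sum]
      refine Fintype.sum_equiv (Equiv.addLeft x) _ _ fun α => ?_
      rw [← coe_map_add, ← zsmul_add]; rfl
    have : ((χ (b • x) : ℂ) - 1) * ∑ α : S, (χ (b • α) : ℂ) = 0 := by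
      rw [sub_mul, hs, one_mul, sub_self]
    refine (mul_eq_zero.1 this).resolve_left (sub_ne_zero.2 ?_)
    rwa [Ne, coe_eq_one_iff hχ]

end Characters

end TypeBLoop

/-! ### The quantum torus in matrices of Laurent polynomials. -/

namespace TypeBLoop

open AddMonoidAlgebra

variable {S : Type*} [AddCommGroup S]

/-- The matrix of Laurent polynomials realising the generator of the quantum torus of degree `n`
attached to `α`: its entry at `(i, j)` is `χ(-(wᵢ + wⱼ)α) t^k` if `n = wⱼ - wᵢ + (2l+1)k`. -/
noncomputable def torusMatrix (χ : AddChar S ℂˣ) (l : ℕ) (α : S) (n : ℤ) :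
    Matrix (Idx l) (Idx l) (LaurentPolynomial ℂ) :=
  Matrix.of fun i j =>
    if (2 * l + 1 : ℤ) ∣ n - wt j + wt i then
      single ((n - wt j + wt i) / (2 * l + 1)) (χ (-(wt i + wt j) • α) : ℂ)
    else 0

/-- The transpose with respect to the antidiagonal. -/
def antiTranspose {l : ℕ} {R : Type*} (A : Matrix (Idx l) (Idx l) R) : Matrix (Idx l) (Idx l) R :=
  A.transpose.submatrix opp opp

variable {χ : AddChar S ℂˣ} {l : ℕ}

/-- The reflection fixes wⱼ - wᵢ and negates wᵢ + wⱼ; this is why the character in `torusMatrix` is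
evaluated at a symmetric combination of weights. -/
theorem antiTranspose_torusMatrix (α : S) (n : ℤ) :
    antiTranspose (torusMatrix χ l α n) = torusMatrix χ l (-α) n := by
  ext1 i j
  simp only [antiTranspose, torusMatrix, Matrix.submatrix_apply, Matrix.transpose_apply,
    Matrix.of_apply, wt_opp]
  rw [show n - -wt i + -wt j = n - wt j + wt i by ring,
    show -(-wt j + -wt i) • α = -(wt i + wt j) • -α by
      rw [smul_neg, ← neg_smul]; congr 1; ring]

/-- Each row has exactly one nonzero entry, so the sum collapses to the index h with w_h ≡ n + wᵢ.
This congruence and wⱼ ≡ m + w_h rewrite both exponents in terms of wᵢ + wⱼ. -/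
theorem torusMatrix_mul (hS : Nat.card S = 2 * l + 1) (α β : S) (n m : ℤ) :
    torusMatrix χ l α n * torusMatrix χ l β m =
      (χ (m • α - n • β) : ℂ) • torusMatrix χ l (α + β) (m + n) := by
  have hN : (2 * l + 1 : ℤ) ≠ 0 := by omega
  ext1 i j
  rw [Matrix.mul_apply, Matrix.smul_apply]
  simp only [torusMatrix, Matrix.of_apply]
  obtain ⟨h, hh⟩ := exists_wt_mod l (n + wt i)
  rw [Finset.sum_eq_single h]
  · rw [if_pos (hh.trans (dvd_of_eq (by ring)))]
    by_cases hd : (2 * l + 1 : ℤ) ∣ m + n - wt j + wt i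
    · have hd' : (2 * l + 1 : ℤ) ∣ m - wt j + wt h := (dvd_sub hd hh).trans (dvd_of_eq (by ring))
      rw [if_pos hd, if_pos hd', single_mul_single, smul_single, smul_eq_mul]
      congr 1
      · rw [← Int.add_ediv_of_dvd_right hd']
        congr 1; ring
      · rw [← coe_map_add, ← coe_map_add]
        congr 2
        have e1 := zsmul_congr_of_dvd hS (a := -(wt i + wt h)) (b := m - (wt i + wt j))
          ((dvd_neg.2 hd').trans (dvd_of_eq (by ring))) α
        have e2 := zsmul_congr_of_dvd hS (a := -(wt h + wt j)) (b := -n - (wt i + wt j))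
          (hh.trans (dvd_of_eq (by ring))) β
        rw [e1, e2, smul_add]
        simp only [sub_smul, neg_smul]
        abel
    · have hd' : ¬ (2 * l + 1 : ℤ) ∣ m - wt j + wt h := fun hd' =>
        hd ((dvd_add hh hd').trans (dvd_of_eq (by ring)))
      rw [if_neg hd, if_neg hd', mul_zero, smul_zero]
  · intro k _ hk
    rw [if_neg, zero_mul]
    intro hd
    exact hk (wt_inj_mod ((dvd_sub hh hd).trans (dvd_of_eq (by ring))))
  · simp

/-- The Euler derivation `t d/dt` of the Laurent polynomials. -/
noncomputable def euler : LaurentPolynomial ℂ →ₗ[ℂ] LaurentPolynomial ℂ :=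
  (AddMonoidAlgebra.basis ℤ ℂ).constr ℂ fun n => single n (n : ℂ)

theorem euler_single (n : ℤ) (r : ℂ) : euler (single n r) = single n (n * r) := by
  have : single n r = r • (AddMonoidAlgebra.basis ℤ ℂ n) := by
    rw [AddMonoidAlgebra.basis_apply, smul_single, smul_eq_mul, mul_one]
  rw [this, map_smul, euler, Module.Basis.constr_basis, smul_single, smul_eq_mul, mul_comm]

/-- The constant coefficient of the trace of a matrix of Laurent polynomials. -/
noncomputable def traceRes : Matrix (Idx l) (Idx l) (LaurentPolynomial ℂ) →ₗ[ℂ] ℂ where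
  toFun A := ∑ i, (A i i).coeff 0
  map_add' A B := by simp [Finset.sum_add_distrib]
  map_smul' r A := by simp [mul_add, Finset.mul_sum]

theorem traceRes_mul_comm (A B : Matrix (Idx l) (Idx l) (LaurentPolynomial ℂ)) :
    traceRes (A * B) = traceRes (B * A) := by
  have : ∀ A : Matrix (Idx l) (Idx l) (LaurentPolynomial ℂ),
      traceRes A = A.trace.coeff 0 := fun A => by
    simp [traceRes, Matrix.trace, AddMonoidAlgebra.coeff_sum]
  rw [this, this, Matrix.trace_mul_comm]

/-- The diagonal matrix of the weights. -/
noncomputable def wtMatrix (l : ℕ) : Matrix (Idx l) (Idx l) (LaurentPolynomial ℂ) :=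
  Matrix.diagonal fun i => single 0 (wt i : ℂ)

/-- Homogeneity of degree n: the commutator with the weight matrix multiplies the (i, j) entry by wᵢ
- wⱼ, and n + wᵢ - wⱼ is 2l + 1 times the exponent of t. -/
theorem map_euler_torusMatrix (α : S) (n : ℤ) :
    (2 * l + 1 : ℂ) • (torusMatrix χ l α n).map euler =
      (n : ℂ) • torusMatrix χ l α n +
        (wtMatrix l * torusMatrix χ l α n - torusMatrix χ l α n * wtMatrix l) := by
  ext1 i j
  simp only [Matrix.smul_apply, Matrix.map_apply, Matrix.add_apply, Matrix.sub_apply, wtMatrix,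
    Matrix.diagonal_mul, Matrix.mul_diagonal, torusMatrix, Matrix.of_apply]
  split_ifs with h
  · obtain ⟨k, hk⟩ := h
    have hN : (2 * l + 1 : ℤ) ≠ 0 := by omega
    rw [hk, Int.mul_ediv_cancel_left _ hN, euler_single, single_mul_single, single_mul_single,
      smul_single, smul_single, zero_add, add_zero, ← single_sub, ← single_add]
    congr 1
    have : (n - wt j + wt i : ℂ) = (2 * l + 1) * k := by exact_mod_cast hk
    simp only [smul_eq_mul]
    linear_combination (-(χ (-(wt i + wt j) • α) : ℂ)) * this
  · simp

/-- The summand `+ 0` matches the exponent in `sum_wt_char`. -/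
theorem coeff_torusMatrix_diag (α : S) (n : ℤ) (i : Idx l) :
    (torusMatrix χ l α n i i).coeff 0 =
      if n = 0 then (χ ((2 * wt i + 0) • -α) : ℂ) else 0 := by
  have hN : (2 * l + 1 : ℤ) ≠ 0 := by omega
  simp only [torusMatrix, Matrix.of_apply, sub_add_cancel]
  split_ifs with h1 h2 h2
  · subst h2
    simp only [Int.zero_ediv, coeff_single, Finsupp.single_eq_same]
    congr 2
    rw [smul_neg, ← neg_smul]; congr 1; ring
  · obtain ⟨k, rfl⟩ := h1
    rw [Int.mul_ediv_cancel_left _ hN, coeff_single, Finsupp.single_eq_of_ne]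
    rintro rfl; simp at h2
  · subst h2; simp at h1
  · simp

theorem traceRes_torusMatrix (hS : Nat.card S = 2 * l + 1) (hχ : Function.Injective χ) (α : S)
    (n : ℤ) [Decidable (α = 0)] :
    traceRes (torusMatrix χ l α n) = if n = 0 then if α = 0 then (2 * l + 1 : ℂ) else 0 else 0 := by
  classical
  simp only [traceRes, LinearMap.coe_mk, AddHom.coe_mk, coeff_torusMatrix_diag]
  split_ifs with h1 h2
  · rw [sum_wt_char hS hχ, if_pos (by simpa using h2)]
  · rw [sum_wt_char hS hχ, if_neg (by simpa using h2)]
  · simp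

theorem traceRes_wtMatrix_mul_eq (α : S) (n : ℤ) :
    traceRes (wtMatrix l * torusMatrix χ l α n) =
      if n = 0 then ∑ i : Idx l, (wt i : ℂ) * (χ ((2 * wt i + 0) • -α) : ℂ) else 0 := by
  have hw : ∀ i : Idx l, ((wtMatrix l * torusMatrix χ l α n) i i).coeff 0 =
      wt i * (torusMatrix χ l α n i i).coeff 0 := by
    intro i
    rw [wtMatrix, Matrix.diagonal_mul]
    have : (single 0 (wt i : ℂ) : LaurentPolynomial ℂ) * torusMatrix χ l α n i i =
        (wt i : ℂ) • torusMatrix χ l α n i i := by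
      exact (LaurentPolynomial.smul_eq_C_mul (R := ℂ) (r := (wt i : ℂ))
        (torusMatrix χ l α n i i)).symm
    rw [this]; simp
  simp only [traceRes, LinearMap.coe_mk, AddHom.coe_mk, hw, coeff_torusMatrix_diag]
  split_ifs <;> simp

theorem traceRes_wtMatrix_mul (hS : Nat.card S = 2 * l + 1) (hχ : Function.Injective χ) {α : S}
    (hα : α ≠ 0) (n : ℤ) :
    traceRes (wtMatrix l * torusMatrix χ l α n) =
      if n = 0 then -(2 * l + 1 : ℂ) / ((χ α : ℂ) - (χ α : ℂ)⁻¹) else 0 := by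
  rw [traceRes_wtMatrix_mul_eq]
  split_ifs with h
  · set x : ℂ := (χ α : ℂ) with hx
    have hx0 : x ≠ 0 := Units.ne_zero _
    have hxN : x ^ (2 * l + 1) = 1 := coe_pow_card χ hS α
    set q : ℂ := (χ ((2 : ℤ) • -α) : ℂ) with hq
    have hqx : q = x ^ (-2 : ℤ) := by
      rw [hq, hx, ← coe_map_zsmul]; congr 2; simp
    have hq1 : q ≠ 1 := by
      rw [Ne, coe_eq_one_iff hχ]
      exact fun h2 => hα (neg_eq_zero.1 (eq_zero_of_two_zsmul hS h2))
    have e := sum_wt_mul_zpow_wt (coe_pow_card χ hS _) hq1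
    have : ∀ i : Idx l, (χ ((2 * wt i + 0) • -α) : ℂ) = q ^ wt i := by
      intro i
      rw [hq, ← coe_map_zsmul, ← mul_zsmul]; congr 3; ring
    simp_rw [this]
    -- Here q = x⁻², so q⁻ˡ = x²ˡ = x⁻¹ because x has order dividing 2l + 1.
    have hql : q ^ (-l : ℤ) = x⁻¹ := by
      rw [hqx, ← zpow_mul, show (-2 : ℤ) * -l = (2 * l + 1 : ℕ) + (-1) by push_cast; ring,
        zpow_add₀ hx0, zpow_natCast, hxN]; simp
    rw [hql] at e
    have hx2 : x ^ 2 ≠ 1 := by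
      intro h; apply hq1; rw [hqx, zpow_neg]; simpa using h
    have hq' : q = (x ^ 2)⁻¹ := by rw [hqx, zpow_neg]; rfl
    rw [← hq] at e
    generalize ∑ i : Idx l, (wt i : ℂ) * q ^ wt i = Z at e ⊢
    rw [hq'] at e
    have hd : x - x⁻¹ ≠ 0 := by
      intro h; apply hx2; field_simp at h; linear_combination h
    rw [eq_div_iff hd]
    field_simp at e ⊢
    linear_combination -e
  · rfl

end TypeBLoop

namespace TypeBLoop

open AddMonoidAlgebra AffineLie
open scoped TensorProduct

/-! ### The residue cocycle and the q-integers. -/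

section Cocycle

variable {S : Type*} [AddCommGroup S] {χ : AddChar S ℂˣ} {l : ℕ}

theorem qInt_coe_char (hS : Nat.card S = 2 * l + 1) (hχ : Function.Injective χ) {γ : S}
    (hγ : γ ≠ 0) (m : ℤ) :
    QVirasoro.qInt (χ γ : ℂ) m =
      ((χ (m • γ) : ℂ) - (χ (-(m • γ)) : ℂ)) / ((χ γ : ℂ) - (χ γ : ℂ)⁻¹) := by
  have h1 : (χ γ : ℂ) ≠ 1 := by rwa [Ne, coe_eq_one_iff hχ]
  -- The value -1 would have odd order.
  have h2 : (χ γ : ℂ) ≠ -1 := by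
    intro h
    have := coe_pow_card χ hS γ
    rw [h, Odd.neg_one_pow ⟨l, rfl⟩] at this
    norm_num at this
  rw [QVirasoro.qInt, if_neg h1, if_neg h2, ← neg_zsmul, coe_map_zsmul, coe_map_zsmul]

theorem qInt_coe_char_neg (hS : Nat.card S = 2 * l + 1) (hχ : Function.Injective χ) (γ : S)
    (m : ℤ) : QVirasoro.qInt (χ (-γ) : ℂ) m = QVirasoro.qInt (χ γ : ℂ) m := by
  by_cases hγ : γ = 0
  · simp [hγ]
  · rw [qInt_coe_char hS hχ hγ, qInt_coe_char hS hχ (neg_ne_zero.2 hγ), smul_neg, neg_neg,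
      AddChar.map_neg_eq_inv χ γ, Units.val_inv_eq_inv_val, inv_inv, ← neg_sub (χ (m • γ) : ℂ),
      ← neg_sub (χ γ : ℂ), neg_div_neg_eq]

/-- By `map_euler_torusMatrix` and cyclicity, 2l + 1 times the left side is m tr(TT') plus the
weighted trace of [T', T]. For α + β = 0 and m + n = 0 the factors commute and the first term gives
[m]_1 = m; for α + β ≠ 0 the first term vanishes and the second gives the quotient defining [m]_q.
-/
theorem traceRes_mul_map_euler (hS : Nat.card S = 2 * l + 1) (hχ : Function.Injective χ)
    (α β : S) (n m : ℤ) :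
    traceRes (torusMatrix χ l α n * (torusMatrix χ l β m).map euler) =
      if m + n = 0 then QVirasoro.qInt (χ (α + β) : ℂ) m else 0 := by
  classical
  have hN : (2 * l + 1 : ℂ) ≠ 0 := by exact_mod_cast (by omega : 2 * l + 1 ≠ 0)
  have h1 : traceRes (torusMatrix χ l α n * (wtMatrix l * torusMatrix χ l β m)) =
      traceRes (wtMatrix l * (torusMatrix χ l β m * torusMatrix χ l α n)) := by
    rw [traceRes_mul_comm, Matrix.mul_assoc]
  have h2 : traceRes (torusMatrix χ l α n * (torusMatrix χ l β m * wtMatrix l)) =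
      traceRes (wtMatrix l * (torusMatrix χ l α n * torusMatrix χ l β m)) := by
    rw [← Matrix.mul_assoc, traceRes_mul_comm]
  have key := congrArg (fun A => traceRes (torusMatrix χ l α n * A))
    (map_euler_torusMatrix (χ := χ) (l := l) β m)
  simp only [Matrix.mul_smul, Matrix.mul_add, Matrix.mul_sub, map_smul, map_add, map_sub, h1, h2,
    torusMatrix_mul hS] at key
  rw [traceRes_torusMatrix hS hχ, add_comm β α, add_comm n m] at key
  apply mul_left_cancel₀ hN
  rw [← smul_eq_mul, key]
  by_cases hmn : m + n = 0
  · have hn : n = -m := by omega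
    subst hn
    by_cases hγ : α + β = 0
    · have hβ : β = -α := by rw [eq_neg_iff_add_eq_zero, add_comm, hγ]
      subst hβ
      simp [QVirasoro.qInt]
      ring
    · simp only [traceRes_wtMatrix_mul hS hχ hγ, if_neg hγ, qInt_coe_char hS hχ hγ, hmn, if_true,
        smul_eq_mul]
      rw [show m • α - -m • β = m • (α + β) by simp only [smul_add, neg_smul]; abel,
        show -m • β - m • α = -(m • (α + β)) by simp only [smul_add, neg_smul]; abel]
      ring
  · simp [traceRes_wtMatrix_mul_eq, hmn]

end Cocycle

/-! ### The loop algebra of type B as antisymmetric matrices of Laurent polynomials. -/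

section Realisation

variable {l : ℕ}

/-- The values of the bilinear form defining the Lie algebra of type `B_l` on opposite vectors. -/
def formValue {l : ℕ} : Idx l → ℂ
  | .inl _ => 2
  | .inr _ => 1

/-- The factors of the rescaling of the basis that turns all values of the form into `1`. -/
noncomputable def scale {l : ℕ} : Idx l → ℂ
  | .inl _ => (Real.sqrt 2 : ℂ)
  | .inr _ => 1

theorem scale_mul_scale_opp (i : Idx l) : scale i * scale (opp i) = formValue i := by
  rcases i with i | i | i
  · simp only [scale, opp, formValue]
    rw [← Complex.ofReal_mul, Real.mul_self_sqrt (by norm_num)]; simp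
  · simp [scale, opp, formValue]
  · simp [scale, opp, formValue]

theorem scale_ne_zero (i : Idx l) : scale i ≠ 0 := by
  rcases i with i | i
  · simp [scale]
  · simp [scale]

theorem JB_apply (i j : Idx l) :
    LieAlgebra.Orthogonal.JB (Fin l) ℂ i j = if j = opp i then formValue i else 0 := by
  rcases i with i | i | i <;> rcases j with j | j | j <;>
    simp [LieAlgebra.Orthogonal.JB, LieAlgebra.Orthogonal.JD, opp, formValue, Matrix.one_apply,
      eq_comm]

theorem mem_typeB_iff (A : Matrix (Idx l) (Idx l) ℂ) :
    A ∈ LieAlgebra.Orthogonal.typeB (Fin l) ℂ ↔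
      ∀ i j, A (opp j) i * formValue (opp j) = -(formValue i * A (opp i) j) := by
  rw [LieAlgebra.Orthogonal.typeB, mem_skewAdjointMatricesLieSubalgebra,
    mem_skewAdjointMatricesSubmodule, Matrix.IsSkewAdjoint, Matrix.IsAdjointPair, ← Matrix.ext_iff]
  refine forall₂_congr fun i j => ?_
  rw [Matrix.mul_apply, Matrix.mul_apply, Finset.sum_eq_single (opp j),
    Finset.sum_eq_single (opp i)]
  · simp [JB_apply]
  · intro k _ hk; rw [JB_apply, if_neg hk, zero_mul]
  · simp
  · intro k _ hk
    rw [JB_apply, if_neg, mul_zero]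
    rintro rfl
    simp at hk
  · simp

/-- The matrix of an element of the Lie algebra of type `B_l` in the rescaled basis. -/
noncomputable def rescale (l : ℕ) : B l →ₗ[ℂ] Matrix (Idx l) (Idx l) ℂ where
  toFun X := Matrix.of fun i j => scale i * X.1 i j * (scale j)⁻¹
  map_add' X Y := by ext1 i j; simp; ring
  map_smul' r X := by ext1 i j; simp; ring

theorem rescale_apply (X : B l) (i j : Idx l) :
    rescale l X i j = scale i * X.1 i j * (scale j)⁻¹ := rfl

theorem rescale_lie (X Y : B l) :
    rescale l ⁅X, Y⁆ = rescale l X * rescale l Y - rescale l Y * rescale l X := by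
  have h : ∀ X Y : B l, rescale l X * rescale l Y =
      Matrix.of fun i j => scale i * (X.1 * Y.1) i j * (scale j)⁻¹ := by
    intro X Y
    ext1 i j
    rw [Matrix.mul_apply, Matrix.of_apply, Matrix.mul_apply, Finset.mul_sum, Finset.sum_mul]
    refine Finset.sum_congr rfl fun k _ => ?_
    rw [rescale_apply, rescale_apply]
    field_simp [scale_ne_zero k]
  rw [h, h]
  ext1 i j
  simp only [rescale_apply, LieSubalgebra.coe_bracket, Ring.lie_def, Matrix.sub_apply,
    Matrix.of_apply]
  ring

theorem trace_rescale_mul (X Y : B l) :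
    (rescale l X * rescale l Y).trace = (X.1 * Y.1).trace := by
  simp only [Matrix.trace, Matrix.diag_apply, Matrix.mul_apply, rescale_apply]
  refine Finset.sum_congr rfl fun i _ => Finset.sum_congr rfl fun k _ => ?_
  have := scale_ne_zero i
  have := scale_ne_zero k
  field_simp

/-- In the rescaled basis the form pairs each index with its opposite with value 1, so skew-adjoint
means antisymmetric under the antidiagonal reflection. -/
theorem rescale_opp (X : B l) (i j : Idx l) : rescale l X (opp j) (opp i) = -rescale l X i j := by
  have h := (mem_typeB_iff X.1).1 X.2 (opp i) j
  rw [← scale_mul_scale_opp, ← scale_mul_scale_opp, opp_opp, opp_opp] at h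
  have := scale_ne_zero i
  have := scale_ne_zero j
  have := scale_ne_zero (opp i)
  have := scale_ne_zero (opp j)
  rw [rescale_apply, rescale_apply]
  field_simp
  linear_combination h

/-- The antisymmetrisation of a matrix, as an element of the Lie algebra of type `B_l`. -/
noncomputable def skewPart (l : ℕ) : Matrix (Idx l) (Idx l) ℂ →ₗ[ℂ] B l where
  toFun A := ⟨Matrix.of fun i j => (scale i)⁻¹ * (A i j - A (opp j) (opp i)) * scale j, by
    rw [mem_typeB_iff]
    intro i j
    rw [← scale_mul_scale_opp, ← scale_mul_scale_opp, opp_opp]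
    have := scale_ne_zero (opp i)
    have := scale_ne_zero (opp j)
    simp only [Matrix.of_apply, opp_opp]
    field_simp
    ring⟩
  map_add' A A' := by ext i j; simp; ring
  map_smul' r A := by ext i j; simp; ring

theorem rescale_skewPart (A : Matrix (Idx l) (Idx l) ℂ) :
    rescale l (skewPart l A) = A - antiTranspose A := by
  ext1 i j
  have := scale_ne_zero i
  have := scale_ne_zero j
  simp only [rescale_apply, skewPart, LinearMap.coe_mk, AddHom.coe_mk, Matrix.of_apply,
    Matrix.sub_apply, antiTranspose, Matrix.submatrix_apply, Matrix.transpose_apply]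
  field_simp

/-- Antisymmetrising an already antisymmetric matrix doubles it; this 2 is the source of the factors
1/2 in the Fourier inversion. -/
theorem skewPart_rescale (X : B l) : skewPart l (rescale l X) = (2 : ℂ) • X := by
  apply Subtype.ext
  ext1 i j
  have := scale_ne_zero i
  have := scale_ne_zero j
  simp only [skewPart, LinearMap.coe_mk, AddHom.coe_mk, Matrix.of_apply, rescale_opp]
  rw [rescale_apply]
  change _ = 2 * X.1 i j
  field_simp
  ring

/-- The loop algebra of the Lie algebra of type `B_l`. -/
abbrev LoopB (l : ℕ) := LieAlgebra.loopAlgebra ℂ ℤ (B l)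

/-- An element of the loop algebra as a matrix of Laurent polynomials. -/
noncomputable def loopMatrix (l : ℕ) :
    LoopB l →ₗ[ℂ] Matrix (Idx l) (Idx l) (LaurentPolynomial ℂ) :=
  TensorProduct.lift <| LinearMap.mk₂ ℂ
    (fun (p : LaurentPolynomial ℂ) (X : B l) => (rescale l X).map fun c => c • p)
    (by intro p q X; ext1 i j; simp)
    (by intro r p X; ext1 i j; exact smul_comm (rescale l X i j) r p)
    (by intro p X Y; ext1 i j; simp [add_smul]) (by intro r p X; ext1 i j; simp [mul_smul])

theorem loopMatrix_tmul (p : LaurentPolynomial ℂ) (X : B l) :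
    loopMatrix l (p ⊗ₜ X) = (rescale l X).map fun c => c • p := rfl

theorem loopMatrix_lie (x y : LoopB l) :
    loopMatrix l ⁅x, y⁆ = loopMatrix l x * loopMatrix l y - loopMatrix l y * loopMatrix l x := by
  induction x using TensorProduct.induction_on with
  | zero => rw [show ⁅(0 : LoopB l), y⁆ = 0 from zero_lie y]; simp
  | add x x' hx hx' =>
    rw [show ⁅(x + x' : LoopB l), y⁆ = ⁅x, y⁆ + ⁅x', y⁆ from add_lie x x' y, map_add, map_add, hx, hx']
    noncomm_ring
  | tmul p X =>
    induction y using TensorProduct.induction_on with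
    | zero =>
      have h := lie_zero (L := LoopB l) (M := LoopB l) (p ⊗ₜ[ℂ] X)
      rw [map_zero, mul_zero, zero_mul, sub_zero, ← map_zero (loopMatrix l)]
      exact congrArg _ h
    | add y y' hy hy' =>
      have h := congrArg (loopMatrix l)
        (lie_add (L := LoopB l) (M := LoopB l) (p ⊗ₜ[ℂ] X) y y')
      refine h.trans ?_
      rw [map_add, map_add]
      refine (congrArg₂ (· + ·) hy hy').trans ?_
      noncomm_ring
    | tmul q Y =>
      have h : ∀ (p q : LaurentPolynomial ℂ) (A A' : Matrix (Idx l) (Idx l) ℂ),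
          (A.map fun c => c • p) * (A'.map fun c => c • q) = (A * A').map fun c => c • (p * q) := by
        intro p q A A'
        ext1 i j
        simp only [Matrix.mul_apply, Matrix.map_apply, Finset.sum_smul, smul_mul_smul_comm]
      rw [LieAlgebra.ExtendScalars.bracket_tmul, loopMatrix_tmul, loopMatrix_tmul, loopMatrix_tmul,
        h, h, rescale_lie, mul_comm q p]
      ext1 i j
      simp only [Matrix.map_apply, Matrix.sub_apply, sub_smul]

/-- The antisymmetrisation of a matrix of Laurent polynomials, as an element of the loop algebra
of the Lie algebra of type `B_l`. -/
noncomputable def loopSkewPart (l : ℕ) :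
    Matrix (Idx l) (Idx l) (LaurentPolynomial ℂ) →ₗ[ℂ] LoopB l where
  toFun A := ∑ i, ∑ j, A i j ⊗ₜ[ℂ] skewPart l (Matrix.single i j 1)
  map_add' A A' := by
    simp only [Matrix.add_apply, TensorProduct.add_tmul, Finset.sum_add_distrib]
  map_smul' r A := by
    simp only [Matrix.smul_apply, ← TensorProduct.smul_tmul', Finset.smul_sum, RingHom.id_apply]

theorem loopSkewPart_apply (A : Matrix (Idx l) (Idx l) (LaurentPolynomial ℂ)) :
    loopSkewPart l A = ∑ i, ∑ j, A i j ⊗ₜ[ℂ] skewPart l (Matrix.single i j 1) := rfl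

theorem loopMatrix_loopSkewPart (A : Matrix (Idx l) (Idx l) (LaurentPolynomial ℂ)) :
    loopMatrix l (loopSkewPart l A) = A - antiTranspose A := by
  simp only [loopSkewPart_apply, map_sum, loopMatrix_tmul, rescale_skewPart]
  ext1 a b
  simp only [Matrix.sum_apply, Matrix.map_apply, Matrix.sub_apply, antiTranspose,
    Matrix.submatrix_apply, Matrix.transpose_apply, sub_smul, Finset.sum_sub_distrib,
    Matrix.single_apply, ite_smul, one_smul, zero_smul]
  simp [ite_and]

theorem loopSkewPart_loopMatrix (x : LoopB l) :
    loopSkewPart l (loopMatrix l x) = (2 : ℂ) • x := by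
  induction x using TensorProduct.induction_on with
  | zero => simp
  | add x x' hx hx' => rw [map_add, map_add, hx, hx', smul_add]
  | tmul p X =>
    have : rescale l X = ∑ i, ∑ j, rescale l X i j • Matrix.single i j (1 : ℂ) := by
      conv_lhs => rw [Matrix.matrix_eq_sum_single (rescale l X)]
      simp
    rw [← TensorProduct.tmul_smul, ← skewPart_rescale, loopSkewPart_apply, loopMatrix_tmul]
    conv_rhs => rw [this]
    simp only [map_sum, map_smul, TensorProduct.tmul_sum, Matrix.map_apply,
      ← TensorProduct.smul_tmul', TensorProduct.tmul_smul]

/-- By bilinearity it suffices to take t^a ⊗ X and t^b ⊗ Y: `euler` supplies the factor b and the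
constant coefficient supplies δ_{a+b,0}. -/
theorem residuePairing_eq_traceRes (x y : LoopB l) :
    LieAlgebra.LoopAlgebra.residuePairing ℂ ℤ (B l) (formB l) x y =
      (1 / 2 : ℂ) * traceRes (loopMatrix l x * (loopMatrix l y).map euler) := by
  have hmap : ∀ A A' : Matrix (Idx l) (Idx l) (LaurentPolynomial ℂ),
      (A + A').map euler = A.map euler + A'.map euler := fun A A' => by
    ext1 i j; simp
  have hsingle : ∀ (a : ℤ) (r : ℂ) (X : B l),
      (single a r : LaurentPolynomial ℂ) ⊗ₜ[ℂ] X = single a 1 ⊗ₜ[ℂ] (r • X) := fun a r X => by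
    rw [← TensorProduct.smul_tmul, smul_single, smul_eq_mul, mul_one]
  induction x using TensorProduct.induction_on with
  | zero => simp
  | add x x' hx hx' =>
    rw [map_add, map_add, LinearMap.add_apply, hx, hx', add_mul, map_add, mul_add]
  | tmul p X =>
    induction p using AddMonoidAlgebra.induction_linear with
    | zero => simp
    | add p p' hp hp' =>
      rw [TensorProduct.add_tmul, map_add, map_add, LinearMap.add_apply, hp, hp', add_mul, map_add,
        mul_add]
    | single a r =>
      rw [hsingle a r]
      generalize r • X = X
      induction y using TensorProduct.induction_on with
      | zero => simp
      | add y y' hy hy' => rw [map_add, map_add, hy, hy', hmap, mul_add, map_add, mul_add]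
      | tmul q Y =>
        induction q using AddMonoidAlgebra.induction_linear with
        | zero => simp
        | add q q' hq hq' =>
          rw [TensorProduct.add_tmul, map_add, map_add, hq, hq', hmap, mul_add, map_add, mul_add]
        | single b s =>
          rw [hsingle b s]
          generalize s • Y = Y
          rw [LieAlgebra.LoopAlgebra.residuePairing_apply_apply,
            LieAlgebra.LoopAlgebra.toFinsupp_single_tmul,
            LieAlgebra.LoopAlgebra.toFinsupp_single_tmul, Finsupp.sum_single_index (by simp),
            loopMatrix_tmul, loopMatrix_tmul]
          have h : traceRes (((rescale l X).map fun c => c • (single a 1 : LaurentPolynomial ℂ)) *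
              (((rescale l Y).map fun c => c • (single b 1 : LaurentPolynomial ℂ)).map euler)) =
              b * (if a + b = 0 then (rescale l X * rescale l Y).trace else 0) := by
            simp only [traceRes, LinearMap.coe_mk, AddHom.coe_mk, Matrix.mul_apply,
              Matrix.map_apply, smul_single, euler_single, single_mul_single,
              AddMonoidAlgebra.coeff_sum, Finsupp.finsetSum_apply, coeff_single,
              Finsupp.single_apply, Matrix.trace, Matrix.diag_apply]
            split_ifs
            · simp only [Finset.mul_sum, smul_eq_mul, mul_one]
              exact Finset.sum_congr rfl fun i _ => Finset.sum_congr rfl fun k _ => by ring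
            · simp
          rw [h, trace_rescale_mul]
          by_cases hab : a + b = 0
          · have hb : -b = a := by omega
            rw [if_pos hab, hb, Finsupp.single_eq_same, zsmul_eq_mul]
            simp only [formB, LinearMap.mk₂_apply]
            ring
          · rw [if_neg hab, Finsupp.single_eq_of_ne (by omega)]
            simp

end Realisation

end TypeBLoop

/-! ### The relations of D_S in the loop algebra. -/

namespace TypeBLoop

open AddMonoidAlgebra AffineLie QVirasoro
open scoped TensorProduct

variable {S : Type*} [AddCommGroup S] {χ : AddChar S ℂˣ} {l : ℕ}

theorem loopMatrix_injective (l : ℕ) : Function.Injective (loopMatrix l) := by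
  intro x y h
  have := congrArg (loopSkewPart l) h
  rw [loopSkewPart_loopMatrix, loopSkewPart_loopMatrix] at this
  exact smul_right_injective _ two_ne_zero this

/-- The image of `D^α(n)` in the loop algebra. -/
noncomputable def loopD (χ : AddChar S ℂˣ) (l : ℕ) (α : S) (n : ℤ) : LoopB l :=
  loopSkewPart l (torusMatrix χ l α n)

theorem loopMatrix_loopD (α : S) (n : ℤ) :
    loopMatrix l (loopD χ l α n) = torusMatrix χ l α n - torusMatrix χ l (-α) n := by
  rw [loopD, loopMatrix_loopSkewPart, antiTranspose_torusMatrix]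

theorem loopD_neg (α : S) (n : ℤ) : loopD χ l (-α) n = -loopD χ l α n := by
  apply loopMatrix_injective
  rw [map_neg, loopMatrix_loopD, loopMatrix_loopD, neg_neg, neg_sub]

/-- The commutator expands into eight torus products, which pair off by degrees ±(α + β) and ±(α -
β). -/
theorem loopD_lie (hS : Nat.card S = 2 * l + 1) (α β : S) (n m : ℤ) :
    ⁅loopD χ l α n, loopD χ l β m⁆ =
      ((χ (m • α - n • β) : ℂ) - (χ (n • β - m • α) : ℂ)) • loopD χ l (α + β) (m + n) -
        ((χ (m • α + n • β) : ℂ) - (χ (-(m • α) - n • β) : ℂ)) • loopD χ l (α - β) (m + n) := by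
  apply loopMatrix_injective
  rw [loopMatrix_lie, map_sub, map_smul, map_smul]
  simp only [loopMatrix_loopD, mul_sub, sub_mul, torusMatrix_mul hS]
  simp only [smul_neg, sub_neg_eq_add, neg_add_eq_sub, neg_sub, neg_add, add_comm n m,
    add_comm β α, ← sub_eq_add_neg]
  rw [show n • β + m • α = m • α + n • β by abel, show -α - β = -β - α by abel,
    show -(n • β) - m • α = -(m • α) - n • β by abel]
  module

/-- Of the four traces, those at γ and -γ agree because [m]_q = [m]_{q⁻¹}; the resulting 2 cancels
the 1/2 of the form. -/
theorem residuePairing_loopD (hS : Nat.card S = 2 * l + 1) (hχ : Function.Injective χ) (α β : S)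
    (n m : ℤ) :
    LieAlgebra.LoopAlgebra.residuePairing ℂ ℤ (B l) (formB l) (loopD χ l α n) (loopD χ l β m) =
      (qInt (χ (α + β) : ℂ) m - qInt (χ (α - β) : ℂ) m) * (if m + n = 0 then 1 else 0) := by
  have hmap : ∀ A A' : Matrix (Idx l) (Idx l) (LaurentPolynomial ℂ),
      (A - A').map euler = A.map euler - A'.map euler := fun A A' => by
    ext1 i j; simp
  rw [residuePairing_eq_traceRes, loopMatrix_loopD, loopMatrix_loopD, hmap]
  simp only [mul_sub, sub_mul, map_sub, traceRes_mul_map_euler hS hχ]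
  rw [← qInt_coe_char_neg hS hχ (-α + -β), ← qInt_coe_char_neg hS hχ (-α + β),
    show -(-α + -β) = α + β by abel, show -(-α + β) = α - β by abel, ← sub_eq_add_neg α β]
  split_ifs <;> ring

/-! ### One-dimensional central extensions in coordinates. -/

section Extension

variable {L : Type*} [LieRing L] [LieAlgebra ℂ L]
  (c : LieModule.Cohomology.twoCocycle ℂ L (TrivialLieModule ℂ L ℂ))

/-- The identification of a one-dimensional central extension with a product of vector spaces. -/
def extMk : (L × ℂ) ≃ₗ[ℂ] LieAlgebra.ofTwoCocycle c where
  toFun p := LieAlgebra.ofProd c (p.1, (TrivialLieModule.equiv ℂ L ℂ).symm p.2)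
  invFun x := (((LieAlgebra.ofProd c).symm x).1,
    TrivialLieModule.equiv ℂ L ℂ ((LieAlgebra.ofProd c).symm x).2)
  map_add' _ _ := rfl
  map_smul' _ _ := rfl
  left_inv _ := rfl
  right_inv _ := rfl

theorem extMk_lie (p q : L × ℂ) :
    ⁅extMk c p, extMk c q⁆ = extMk c (⁅p.1, q.1⁆, TrivialLieModule.equiv ℂ L ℂ
      ((c : L →ₗ[ℂ] L →ₗ[ℂ] TrivialLieModule ℂ L ℂ) p.1 q.1)) := by
  rw [LieAlgebra.bracket_ofTwoCocycle]
  refine congrArg (LieAlgebra.ofProd c) (Prod.ext rfl ?_)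
  dsimp only
  rw [trivial_lie_zero, trivial_lie_zero, sub_zero, add_zero]
  rfl

theorem extMk_central_lie (r : ℂ) (x : LieAlgebra.ofTwoCocycle c) : ⁅extMk c (0, r), x⁆ = 0 := by
  obtain ⟨p, rfl⟩ := (extMk c).surjective x
  rw [extMk_lie]
  dsimp only
  rw [zero_lie, map_zero, LinearMap.zero_apply, map_zero]
  exact map_zero _

/-- The two signs encode c ↦ -k: the affine cocycle is minus the residue pairing, and it is the
latter that yields the central coefficient of D_S. -/
theorem extMk_relation {x y z w : L} {a b r : ℂ} (h : ⁅x, y⁆ = a • z - b • w)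
    (hc : TrivialLieModule.equiv ℂ L ℂ
      ((c : L →ₗ[ℂ] L →ₗ[ℂ] TrivialLieModule ℂ L ℂ) x y) = -r) :
    ⁅extMk c (x, 0), extMk c (y, 0)⁆ =
      a • extMk c (z, 0) - b • extMk c (w, 0) + r • extMk c (0, -1) := by
  rw [extMk_lie]
  dsimp only
  rw [h, hc, ← map_smul, ← map_smul, ← map_smul, ← map_sub, ← map_add]
  simp

theorem extMk_neg (x : L) : extMk c (-x, 0) = -extMk c (x, 0) := by
  rw [← map_neg, Prod.neg_mk, neg_zero]

end Extension

/-! ### Universal property and spanning set of D_S. -/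

/-- The Lie algebra morphism from the quotient by a Lie ideal induced by a morphism that vanishes
on the ideal. -/
def quotientLift {L L' : Type*} [LieRing L] [LieAlgebra ℂ L] [LieRing L'] [LieAlgebra ℂ L']
    (I : LieIdeal ℂ L) (f : L →ₗ⁅ℂ⁆ L') (h : I ≤ f.ker) : L ⧸ I →ₗ⁅ℂ⁆ L' :=
  { I.toSubmodule.liftQ (f : L →ₗ[ℂ] L') fun x hx => (LieHom.mem_ker).1 (h hx) with
    map_lie' := by
      intro x y
      obtain ⟨x, rfl⟩ := LieSubmodule.Quotient.surjective_mk' I x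
      obtain ⟨y, rfl⟩ := LieSubmodule.Quotient.surjective_mk' I y
      exact f.map_lie x y }

/-- Elements of a Lie algebra that satisfy the relations define a morphism from `D_S`. -/
theorem exists_lieHom {L : Type*} [LieRing L] [LieAlgebra ℂ L] {D : S → ℤ → L} {c : L}
    (hodd : ∀ α n, D (-α) n = -D α n) (hc : ∀ x : L, ⁅c, x⁆ = 0)
    (hlie : ∀ α β n m, ⁅D α n, D β m⁆ =
      ((χ (m • α - n • β) : ℂ) - (χ (n • β - m • α) : ℂ)) • D (α + β) (m + n) -
        ((χ (m • α + n • β) : ℂ) - (χ (-(m • α) - n • β) : ℂ)) • D (α - β) (m + n) +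
        ((qInt (χ (α + β) : ℂ) m - qInt (χ (α - β) : ℂ) m) * (if m + n = 0 then 1 else 0)) • c) :
    ∃ f : DS χ →ₗ⁅ℂ⁆ L, (∀ α n, f (LieSubmodule.Quotient.mk (freeD α n)) = D α n) ∧
      f (LieSubmodule.Quotient.mk (freeC S)) = c := by
  let F : FreeLieAlgebra ℂ (Gen S) →ₗ⁅ℂ⁆ L := FreeLieAlgebra.lift ℂ fun
    | Gen.D α n => D α n
    | Gen.c => c
  have hFD : ∀ α n, F (freeD α n) = D α n := fun α n => FreeLieAlgebra.lift_of_apply ..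
  have hFc : F (freeC S) = c := FreeLieAlgebra.lift_of_apply ..
  have hle : relIdeal χ ≤ F.ker := by
    rw [relIdeal, LieSubmodule.lieSpan_le]
    rintro x (⟨α, n⟩ | ⟨α, β, n, m⟩ | ⟨x⟩)
    · simp [hFD, hodd]
    · rw [SetLike.mem_coe, LieHom.mem_ker, map_sub, LieHom.map_lie, bracketRHS, map_add, map_sub,
        map_smul, map_smul, map_smul, hFD, hFD, hFD, hFD, hFc, hlie, sub_self]
    · simp [hFc, hc]
  exact ⟨quotientLift _ F hle, hFD, hFc⟩

/-- `D^α(n)` as an element of `D_S`. -/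
noncomputable def genD (χ : AddChar S ℂˣ) (α : S) (n : ℤ) : DS χ :=
  LieSubmodule.Quotient.mk (freeD α n)

/-- `c` as an element of `D_S`. -/
noncomputable def genC (χ : AddChar S ℂˣ) : DS χ := LieSubmodule.Quotient.mk (freeC S)

theorem mk_eq_of_isRelator {x y : FreeLieAlgebra ℂ (Gen S)} (h : IsRelator χ (x - y)) :
    (LieSubmodule.Quotient.mk x : DS χ) = LieSubmodule.Quotient.mk y :=
  (Submodule.Quotient.eq _).2 (LieSubmodule.subset_lieSpan h)

theorem genD_neg (α : S) (n : ℤ) : genD χ (-α) n = -genD χ α n :=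
  mk_eq_of_isRelator (IsRelator.odd α n)

theorem genC_lie (x : DS χ) : ⁅genC χ, x⁆ = 0 := by
  obtain ⟨x, rfl⟩ := LieSubmodule.Quotient.surjective_mk' _ x
  refine (mk_eq_of_isRelator (y := 0) ?_)
  rw [sub_zero]
  exact IsRelator.central x

theorem genD_lie (α β : S) (n m : ℤ) :
    ⁅genD χ α n, genD χ β m⁆ =
      ((χ (m • α - n • β) : ℂ) - (χ (n • β - m • α) : ℂ)) • genD χ (α + β) (m + n) -
        ((χ (m • α + n • β) : ℂ) - (χ (-(m • α) - n • β) : ℂ)) • genD χ (α - β) (m + n) +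
        ((qInt (χ (α + β) : ℂ) m - qInt (χ (α - β) : ℂ) m) * (if m + n = 0 then 1 else 0)) •
          genC χ :=
  mk_eq_of_isRelator (IsRelator.bracket α β n m)

/-- `D_S` is spanned by `c` and the elements `D^α(n)`. -/
theorem span_genD_genC (χ : AddChar S ℂˣ) :
    Submodule.span ℂ (insert (genC χ) (Set.range fun p : S × ℤ => genD χ p.1 p.2)) = ⊤ := by
  set V := Submodule.span ℂ (insert (genC χ) (Set.range fun p : S × ℤ => genD χ p.1 p.2)) with hV
  have hc : genC χ ∈ V := Submodule.subset_span (Set.mem_insert _ _)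
  have hD : ∀ α n, genD χ α n ∈ V := fun α n =>
    Submodule.subset_span (Set.mem_insert_of_mem _ ⟨(α, n), rfl⟩)
  -- The relations express brackets of the spanning elements linearly in them, so the span is a
  -- subalgebra.
  let K : LieSubalgebra ℂ (DS χ) :=
    { V with
      lie_mem' := by
        intro x y hx hy
        change ⁅x, y⁆ ∈ V
        replace hx : x ∈ V := hx
        replace hy : y ∈ V := hy
        induction hx using Submodule.span_induction with
        | zero => rw [zero_lie]; exact V.zero_mem
        | add x x' _ _ h h' => rw [add_lie]; exact V.add_mem h h'
        | smul r x _ h => rw [smul_lie]; exact V.smul_mem r h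
        | mem x hx =>
          rcases hx with rfl | ⟨⟨α, n⟩, rfl⟩
          · rw [genC_lie]; exact V.zero_mem
          induction hy using Submodule.span_induction with
          | zero => rw [lie_zero]; exact V.zero_mem
          | add x x' _ _ h h' => rw [lie_add]; exact V.add_mem h h'
          | smul r x _ h => rw [lie_smul]; exact V.smul_mem r h
          | mem y hy =>
            rcases hy with rfl | ⟨⟨β, m⟩, rfl⟩
            · rw [← lie_skew, genC_lie, neg_zero]; exact V.zero_mem
            · rw [genD_lie]
              exact V.add_mem (V.sub_mem (V.smul_mem _ (hD _ _)) (V.smul_mem _ (hD _ _)))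
                (V.smul_mem _ hc) }
  let F : FreeLieAlgebra ℂ (Gen S) →ₗ⁅ℂ⁆ K := FreeLieAlgebra.lift ℂ fun
    | Gen.D α n => ⟨genD χ α n, hD α n⟩
    | Gen.c => ⟨genC χ, hc⟩
  let Q : FreeLieAlgebra ℂ (Gen S) →ₗ⁅ℂ⁆ DS χ :=
    { (LieSubmodule.Quotient.mk' (relIdeal χ) : FreeLieAlgebra ℂ (Gen S) →ₗ[ℂ] DS χ) with
      map_lie' := fun {x y} => LieSubmodule.Quotient.mk_bracket (I := relIdeal χ) x y }
  -- The projection from the free Lie algebra factors through `K`, since it does so on generators.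
  have hQ : K.incl.comp F = Q := by
    apply FreeLieAlgebra.hom_ext
    rintro (⟨α, n⟩ | _)
    · simp only [LieHom.comp_apply, F, FreeLieAlgebra.lift_of_apply]; rfl
    · simp only [LieHom.comp_apply, F, FreeLieAlgebra.lift_of_apply]; rfl
  rw [eq_top_iff]
  rintro x -
  obtain ⟨x, rfl⟩ := LieSubmodule.Quotient.surjective_mk' _ x
  have : Q x ∈ K := by rw [← hQ]; exact (F x).2
  exact this

/-- The cocycle that defines the affine Lie algebra of type `B_l`. -/
noncomputable abbrev cocycleB (l : ℕ) :
    LieModule.Cohomology.twoCocycle ℂ (LoopB l) (TrivialLieModule ℂ (LoopB l) ℂ) :=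
  (-1 : ℂ) • LieAlgebra.LoopAlgebra.twoCocycleOfBilinear ℂ ℤ (B l) (formB l) (formB_inv l)
    (formB_symm l)

theorem cocycleB_apply (x y : LoopB l) :
    TrivialLieModule.equiv ℂ (LoopB l) ℂ
      ((cocycleB l : LoopB l →ₗ[ℂ] LoopB l →ₗ[ℂ] TrivialLieModule ℂ (LoopB l) ℂ) x y) =
      -LieAlgebra.LoopAlgebra.residuePairing ℂ ℤ (B l) (formB l) x y :=
  neg_one_smul ℂ (LieAlgebra.LoopAlgebra.residuePairing ℂ ℤ (B l) (formB l) x y)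

end TypeBLoop

namespace TypeBLoop

open AddMonoidAlgebra AffineLie QVirasoro

variable {S : Type*} [AddCommGroup S] {χ : AddChar S ℂˣ} {l : ℕ}

/-! ### Fourier inversion and bijectivity. -/

section Fourier

variable [Fintype S] {V : Type*} [AddCommGroup V] [Module ℂ V]

/-- The linear map that sends the matrix unit `t^k E_{ij}` to the Fourier coefficient of the family
`D^α(n)`, where `n = (2l+1)k + wⱼ - wᵢ`. -/
noncomputable def fourier (χ : AddChar S ℂˣ) (l : ℕ) (D : S → ℤ → V) :
    Matrix (Idx l) (Idx l) (LaurentPolynomial ℂ) →ₗ[ℂ] V :=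
  ∑ i, ∑ j, (((AddMonoidAlgebra.basis ℤ ℂ).constr ℂ fun k : ℤ =>
    (2 * l + 1 : ℂ)⁻¹ • ∑ α : S,
      (χ ((wt i + wt j) • α) : ℂ) • D α ((2 * l + 1) * k + wt j - wt i)) ∘ₗ
        Matrix.entryLinearMap ℂ (LaurentPolynomial ℂ) i j)

theorem basis_constr_single (v : ℤ → V) (k : ℤ) (r : ℂ) :
    (AddMonoidAlgebra.basis ℤ ℂ).constr ℂ v (single k r) = r • v k := by
  have : single k r = r • (AddMonoidAlgebra.basis ℤ ℂ k) := by
    rw [AddMonoidAlgebra.basis_apply, smul_single, smul_eq_mul, mul_one]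
  rw [this, map_smul, Module.Basis.constr_basis]

theorem sum_single {ι : Type*} (s : Finset ι) (k : ℤ) (c : ι → ℂ) :
    ∑ i ∈ s, (single k (c i) : LaurentPolynomial ℂ) = single k (∑ i ∈ s, c i) :=
  (map_sum (lsingle (R := ℂ) (S := ℂ) k) c s).symm

/-- No relation among the `D α n` is needed: row i contributes an average over β weighted by χ((2wᵢ
+ n)(β - α)), and summing over i isolates β = α. -/
theorem fourier_torusMatrix (hS : Nat.card S = 2 * l + 1) (hχ : Function.Injective χ)
    (D : S → ℤ → V) (α : S) (n : ℤ) : fourier χ l D (torusMatrix χ l α n) = D α n := by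
  classical
  have hN : (2 * l + 1 : ℤ) ≠ 0 := by omega
  have hNC : (2 * l + 1 : ℂ) ≠ 0 := by exact_mod_cast hN
  have key : ∀ i : Idx l, (∑ j, (AddMonoidAlgebra.basis ℤ ℂ).constr ℂ (fun k : ℤ =>
      (2 * l + 1 : ℂ)⁻¹ • ∑ β : S,
        (χ ((wt i + wt j) • β) : ℂ) • D β ((2 * l + 1) * k + wt j - wt i))
          (torusMatrix χ l α n i j)) =
      (2 * l + 1 : ℂ)⁻¹ • ∑ β : S, (χ ((2 * wt i + n) • (β - α)) : ℂ) • D β n := by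
    intro i
    obtain ⟨j, hj⟩ := exists_wt_mod l (n + wt i)
    rw [Finset.sum_eq_single j]
    · have hd : (2 * l + 1 : ℤ) ∣ n - wt j + wt i := hj.trans (dvd_of_eq (by ring))
      simp only [torusMatrix, Matrix.of_apply, if_pos hd]
      rw [basis_constr_single, Int.mul_ediv_cancel' hd, smul_comm, Finset.smul_sum]
      congr 1
      refine Finset.sum_congr rfl fun β _ => ?_
      rw [smul_smul, ← coe_map_add]
      have e : ∀ γ : S, (wt i + wt j) • γ = (2 * wt i + n) • γ := fun γ =>
        zsmul_congr_of_dvd hS ((dvd_neg.2 hj).trans (dvd_of_eq (by ring))) γ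
      rw [neg_smul, e, e, smul_sub, neg_add_eq_sub]
      congr 2
      ring
    · intro k _ hk
      have hd : ¬ (2 * l + 1 : ℤ) ∣ n - wt k + wt i := fun hd =>
        hk (wt_inj_mod ((dvd_sub hj hd).trans (dvd_of_eq (by ring))))
      simp only [torusMatrix, Matrix.of_apply, if_neg hd, map_zero]
    · simp
  simp only [fourier, LinearMap.sum_apply, LinearMap.comp_apply, Matrix.entryLinearMap_apply, key]
  rw [← Finset.smul_sum, Finset.sum_comm]
  simp only [← Finset.sum_smul, sum_wt_char hS hχ, sub_eq_zero, ite_smul, zero_smul]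
  rw [Finset.sum_ite_eq' Finset.univ α, if_pos (Finset.mem_univ _), smul_smul,
    inv_mul_cancel₀ hNC, one_smul]

theorem fourier_torusMatrix_eq_id (hS : Nat.card S = 2 * l + 1) (hχ : Function.Injective χ) :
    fourier χ l (torusMatrix χ l) = LinearMap.id := by
  classical
  have hN : (2 * l + 1 : ℤ) ≠ 0 := by omega
  have hNC : (2 * l + 1 : ℂ) ≠ 0 := by exact_mod_cast hN
  have key : ∀ (i j : Idx l) (k : ℤ), (2 * l + 1 : ℂ)⁻¹ • ∑ α : S,
      (χ ((wt i + wt j) • α) : ℂ) • torusMatrix χ l α ((2 * l + 1) * k + wt j - wt i) =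
        Matrix.single i j (single k 1) := by
    intro i j k
    ext1 a b
    simp only [Matrix.smul_apply, Matrix.sum_apply, torusMatrix, Matrix.of_apply]
    by_cases hd : (2 * l + 1 : ℤ) ∣ (2 * l + 1) * k + wt j - wt i - wt b + wt a
    · simp only [if_pos hd, smul_single, smul_eq_mul, ← coe_map_add, ← add_smul, sum_single]
      rw [sum_char_group hS hχ]
      by_cases hs : (2 * l + 1 : ℤ) ∣ wt i + wt j + -(wt a + wt b)
      -- Sum and difference of the two weights are both known modulo 2l + 1, and 2 is invertible
      -- there: 1·(2l + 1) - l·2 = 1.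
      · have h1 : (2 * l + 1 : ℤ) ∣ wt j - wt b := by
          have h2 : (2 * l + 1 : ℤ) ∣ 2 * (wt j - wt b) :=
            (dvd_sub (dvd_add hd hs) (dvd_mul_right (2 * l + 1 : ℤ) k)).trans
              (dvd_of_eq (by ring))
          refine IsCoprime.dvd_of_dvd_mul_left ⟨1, -l, by ring⟩ h2
        obtain rfl := wt_inj_mod h1
        obtain rfl : i = a := wt_inj_mod (hs.trans (dvd_of_eq (by ring)))
        rw [if_pos hs, Matrix.single_apply_same, inv_mul_cancel₀ hNC]
        congr 1
        rw [show (2 * l + 1) * k + wt j - wt i - wt j + wt i = (2 * l + 1) * k by ring,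
          Int.mul_ediv_cancel_left _ hN]
      · rw [if_neg hs, mul_zero, single_zero, Matrix.single_apply_of_ne]
        rintro ⟨rfl, rfl⟩
        simp at hs
    · simp only [if_neg hd, smul_zero, Finset.sum_const_zero]
      rw [Matrix.single_apply_of_ne]
      rintro ⟨rfl, rfl⟩
      exact hd ((dvd_mul_right (2 * l + 1 : ℤ) k).trans (dvd_of_eq (by ring)))
  refine LinearMap.ext fun A => ?_
  have hs : ∀ (i j : Idx l) (p : LaurentPolynomial ℂ),
      (AddMonoidAlgebra.basis ℤ ℂ).constr ℂ
        (fun k : ℤ => (Matrix.single i j (single k 1) :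
          Matrix (Idx l) (Idx l) (LaurentPolynomial ℂ))) p = Matrix.single i j p := by
    intro i j p
    induction p using AddMonoidAlgebra.induction_linear with
    | zero => simp
    | add p q hp hq => rw [map_add, hp, hq, Matrix.single_add]
    | single k r =>
      rw [basis_constr_single, Matrix.smul_single, smul_single, smul_eq_mul, mul_one]
  simp only [fourier, key, LinearMap.sum_apply, LinearMap.comp_apply,
    Matrix.entryLinearMap_apply, hs, LinearMap.id_apply]
  exact (Matrix.matrix_eq_sum_single A).symm

theorem map_fourier {W : Type*} [AddCommGroup W] [Module ℂ W] (g : V →ₗ[ℂ] W) (D : S → ℤ → V)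
    (A : Matrix (Idx l) (Idx l) (LaurentPolynomial ℂ)) :
    g (fourier χ l D A) = fourier χ l (fun α n => g (D α n)) A := by
  have : ∀ (v : ℤ → V) (p : LaurentPolynomial ℂ),
      g ((AddMonoidAlgebra.basis ℤ ℂ).constr ℂ v p) =
        (AddMonoidAlgebra.basis ℤ ℂ).constr ℂ (fun k => g (v k)) p := by
    intro v p
    induction p using AddMonoidAlgebra.induction_linear with
    | zero => simp
    | add p q hp hq => simp only [map_add, hp, hq]
    | single k r => rw [basis_constr_single, basis_constr_single, map_smul]
  simp only [fourier, LinearMap.sum_apply, LinearMap.comp_apply, map_sum, this, map_smul]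

/-- The loop algebra consists of the Fourier coefficients of the elements `D^α(n)`. -/
theorem fourier_loopD (hS : Nat.card S = 2 * l + 1) (hχ : Function.Injective χ) (x : LoopB l) :
    fourier χ l (loopD χ l) ((1 / 2 : ℂ) • loopMatrix l x) = x := by
  have h := map_fourier (loopSkewPart l) (torusMatrix χ l) (χ := χ) ((1 / 2 : ℂ) • loopMatrix l x)
  rw [fourier_torusMatrix_eq_id hS hχ, LinearMap.id_apply, map_smul, loopSkewPart_loopMatrix,
    smul_smul] at h
  norm_num at h
  rw [map_smul]
  exact h.symm

theorem bijective_of_fourier {M L W : Type*} [AddCommGroup M] [Module ℂ M] [AddCommGroup L]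
    [Module ℂ L] [AddCommGroup W] [Module ℂ W] (hS : Nat.card S = 2 * l + 1)
    (hχ : Function.Injective χ) (e : (L × ℂ) ≃ₗ[ℂ] W) (f : M →ₗ[ℂ] W) (D : S → ℤ → M) (c : M)
    (x : S → ℤ → L) (A : L →ₗ[ℂ] Matrix (Idx l) (Idx l) (LaurentPolynomial ℂ))
    (hspan : Submodule.span ℂ (insert c (Set.range fun p : S × ℤ => D p.1 p.2)) = ⊤)
    (hD : ∀ α n, D (-α) n = -D α n)
    (hA : ∀ α n, A (x α n) = torusMatrix χ l α n - torusMatrix χ l (-α) n)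
    (hx : ∀ y, fourier χ l x ((1 / 2 : ℂ) • A y) = y)
    (hfD : ∀ α n, f (D α n) = e (x α n, 0)) (hfc : f c = e (0, -1)) : Function.Bijective f := by
  -- The candidate inverse: Fourier coefficients of the generators on `L`, and -c for the central
  -- coordinate because `f c = e (0, -1)`.
  let g : W →ₗ[ℂ] M := (((1 / 2 : ℂ) • (fourier χ l D ∘ₗ A)).coprod
    (-(LinearMap.toSpanSingleton ℂ M c))) ∘ₗ e.symm.toLinearMap
  have hg : ∀ y r, g (e (y, r)) = (1 / 2 : ℂ) • fourier χ l D (A y) - r • c := by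
    intro y r
    simp [g, sub_eq_add_neg]
  have hgf : g ∘ₗ f = LinearMap.id := by
    refine LinearMap.ext_on hspan ?_
    rintro _ (rfl | ⟨⟨α, n⟩, rfl⟩)
    · simp [hfc, hg]
    -- Inversion returns D^α(n) - D^{-α}(n) = 2 D^α(n), which the factor 1/2 corrects.
    · simp only [LinearMap.comp_apply, hfD, hg, hA, map_sub, fourier_torusMatrix hS hχ, hD,
        LinearMap.id_apply]
      module
  refine ⟨Function.LeftInverse.injective (g := g) fun y => LinearMap.congr_fun hgf y, fun w => ?_⟩
  obtain ⟨⟨y, r⟩, rfl⟩ := e.surjective w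
  refine ⟨fourier χ l D ((1 / 2 : ℂ) • A y) - r • c, ?_⟩
  have h := map_fourier (χ := χ) (e.toLinearMap ∘ₗ LinearMap.inl ℂ L ℂ) x ((1 / 2 : ℂ) • A y)
  rw [hx] at h
  rw [map_sub, map_smul f r c, hfc, map_fourier]
  simp only [hfD]
  refine (congrArg (· - r • e (0, -1)) h.symm).trans ?_
  simp [← map_smul, ← map_sub]

theorem nonempty_lieEquiv_ofTwoCocycle {L : Type*} [LieRing L] [LieAlgebra ℂ L]
    (hS : Nat.card S = 2 * l + 1) (hχ : Function.Injective χ)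
    (c : LieModule.Cohomology.twoCocycle ℂ L (TrivialLieModule ℂ L ℂ)) (x : S → ℤ → L)
    (A : L →ₗ[ℂ] Matrix (Idx l) (Idx l) (LaurentPolynomial ℂ))
    (hA : ∀ α n, A (x α n) = torusMatrix χ l α n - torusMatrix χ l (-α) n)
    (hx : ∀ y, fourier χ l x ((1 / 2 : ℂ) • A y) = y)
    (hneg : ∀ α n, x (-α) n = -x α n)
    (hlie : ∀ α β n m, ⁅x α n, x β m⁆ =
      ((χ (m • α - n • β) : ℂ) - (χ (n • β - m • α) : ℂ)) • x (α + β) (m + n) -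
        ((χ (m • α + n • β) : ℂ) - (χ (-(m • α) - n • β) : ℂ)) • x (α - β) (m + n))
    (hc : ∀ α β n m, TrivialLieModule.equiv ℂ L ℂ
      ((c : L →ₗ[ℂ] L →ₗ[ℂ] TrivialLieModule ℂ L ℂ) (x α n) (x β m)) =
        -((qInt (χ (α + β) : ℂ) m - qInt (χ (α - β) : ℂ) m) * (if m + n = 0 then 1 else 0))) :
    Nonempty (DS χ ≃ₗ⁅ℂ⁆ LieAlgebra.ofTwoCocycle c) := by
  obtain ⟨f, hD, hC⟩ := exists_lieHom (χ := χ) (D := fun α n => extMk c (x α n, 0))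
    (c := extMk c (0, -1)) (fun α n => by rw [hneg, extMk_neg]) (extMk_central_lie c (-1))
    fun α β n m => extMk_relation c (hlie α β n m) (hc α β n m)
  have hf := bijective_of_fourier hS hχ (extMk c) (f : DS χ →ₗ[ℂ] LieAlgebra.ofTwoCocycle c)
    (genD χ) (genC χ) x A (span_genD_genC χ) genD_neg hA hx hD hC
  exact ⟨LieEquiv.ofBijective f hf⟩

end Fourier

end TypeBLoop

theorem theorem3p7 {S : Type*} [AddCommGroup S] (l : ℕ) (hl : 0 < l)
    (hS : Nat.card S = 2 * l + 1) (χ : AddChar S ℂˣ) (hχ : Function.Injective χ) :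
    Nonempty (QVirasoro.DS χ ≃ₗ⁅ℂ⁆ AffineLie.affineB l) := by
  have : Finite S := Nat.finite_of_card_ne_zero (by omega)
  let _ : Fintype S := Fintype.ofFinite S
  exact TypeBLoop.nonempty_lieEquiv_ofTwoCocycle hS hχ (TypeBLoop.cocycleB l)
    (TypeBLoop.loopD χ l) (TypeBLoop.loopMatrix l) TypeBLoop.loopMatrix_loopD
    (TypeBLoop.fourier_loopD hS hχ) TypeBLoop.loopD_neg (TypeBLoop.loopD_lie hS)
    fun α β n m => (TypeBLoop.cocycleB_apply _ _).trans
      (congrArg Neg.neg (TypeBLoop.residuePairing_loopD hS hχ α β n m))
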